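/- Let $E_d,A_d\in\mathbb{R}^{n_d\times n_d}$, $B_d\in\mathbb{R}^{n_d\times n_u}$, $G_d\in\mathbb{R}^{n_d\times n_{fd}}$, $A_a\in\mathbb{R}^{n_a\times n_a}$, $G_a\in\mathbb{R}^{n_a\times n_{fa}}$, let $f_d:\mathbb{R}^{n_d}\times\mathbb{R}^{n_a}\to\mathbb{R}^{n_{fd}}$ and $f_a:\mathbb{R}^{n_d}\times\mathbb{R}^{n_a}\to\mathbb{R}^{n_{fa}}$, and for $K_d\in\mathbb{R}^{n_u\times n_d}$ consider the closed-loop nonlinear differential-algebraic system (NDAE) $$E_d\dot x_d=(A_d+B_dK_d)x_d+G_df_d(x_d,x_a),\qquad 0=A_ax_a+G_af_a(x_d,x_a),$$ whose solutions $(x_d,x_a)$ take values in given sets $\mathcal X_d\subseteq\mathbb{R}^{n_d}$, $\mathcal X_a\subseteq\mathbb{R}^{n_a}$. Assume: 1. $f_d,f_a$ are smooth and vanish at $(0,0)$, and for all $x_d\in\mathcal X_d$, $x_a\in\mathcal X_a$, $$\|f_d(x_d,x_a)\|_2^2\le\|H_d^dx_d\|_2^2+\|H_a^dx_a\|_2^2,\qquad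 \|f_a(x_d,x_a)\|_2^2\le\|H_d^ax_d\|_2^2+\|H_a^ax_a\|_2^2$$ for constant matrices $H_d^d,H_a^d,H_d^a,H_a^a$. 2. $\operatorname{rank}\bigl(A_a+G_a\,\tfrac{\partial f_a}{\partial x_a}(x_d,x_a)\bigr)=n_a$ for all $x_d\in\mathcal X_d$, $x_a\in\mathcal X_a$. Put $\bar H_d=H_d^{d\top}H_d^d+H_d^{a\top}H_d^a$ and $\bar H_a=H_a^{d\top}H_a^d+H_a^{a\top}H_a^a$. In the variables $X_1\in\mathbb{R}^{n_d\times n_d}$, $X_2,Y\in\mathbb{R}^{n_a\times n_d}$, $R\in\mathbb{R}^{n_a\times n_a}$, $W\in\mathbb{R}^{n_u\times n_d}$, $\bar\epsilon\in\mathbb{R}$ consider the linear matrix inequality $$\begin{bmatrix}\Psi&*&*&*\\ A_aX_2E_d^\top+A_aY&\Theta&*&*\\ \bar H_d^{1/2}X_1E_d^\top&O&-\bar\epsilon I&*\\ \bar H_a^{1/2}X_2E_d^\top+\bar H_a^{1/2}Y&\bar H_a^{1/2}R&O&-\bar\epsilon I\end{bmatrix}\prec0,\qquad X_1=X_1^\top\succ0,\quad\bar\epsilon>0,$$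 where $*$ denotes symmetric entries, $\Psi=E_dX_1A_d^\top+A_dX_1E_d^\top+E_dW^\top B_d^\top+B_dWE_d^\top+\bar\epsilon G_dG_d^\top$ and $\Theta=R^\top A_a^\top+A_aR+\bar\epsilon G_aG_a^\top$. The set of feasible points $(X_1,X_2,R,Y,W,\bar\epsilon)$ is convex. If $(X_1,X_2,R,Y,W,\bar\epsilon)$ is feasible, then with the gain $K_d=WX_1^{-1}$ the closed-loop NDAE is asymptotically stable around the origin: for every $\varepsilon>0$ there is $\delta>0$ such that every solution on $[t_0,\infty)$ with values in $\mathcal X_d\times\mathcal X_a$ and $\|x_d(t_0)\|_2,\|x_a(t_0)\|_2<\delta$ satisfies $\|x_d(t)\|_2,\|x_a(t)\|_2<\varepsilon$ for all $t\ge t_0$; and every solution on $[t_0,\infty)$ with values in $\mathcal X_d\times\mathcal X_a$ satisfies $\lim_{t\to\infty}\|x_d(t)\|_2=0$ and $\lim_{t\to\infty}\|x_a(t)\|_2=0$. -/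

import Mathlib

open scoped ContDiff MatrixOrder Matrix Topology
open Filter

/-- The Euclidean space `ℝⁿ` with the norm `‖·‖₂`. -/
abbrev Vec (n : ℕ) : Type := EuclideanSpace ℝ (Fin n)

/-- Real `m × n` matrices. -/
abbrev Mat (m n : ℕ) : Type := Matrix (Fin m) (Fin n) ℝ

/-- The matrix-vector product `M x`, as a vector of Euclidean space. -/
noncomputable def Mat.app {m n : ℕ} (M : Mat m n) (x : Vec n) : Vec m :=
  WithLp.toLp 2 (M *ᵥ x.ofLp)

/-- The data of a nonlinear differential-algebraic control system
`E_d x_d' = A_d x_d + B_d u + G_d f_d(x_d, x_a)`, `0 = A_a x_a + G_a f_a(x_d, x_a)`,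
with dynamic state in `ℝ^{nd}`, algebraic state in `ℝ^{na}` and input in `ℝ^{nu}`. -/
structure NDAE (nd na nu nfd nfa : ℕ) where
  Ed : Mat nd nd
  Ad : Mat nd nd
  Bd : Mat nd nu
  Gd : Mat nd nfd
  fd : Vec nd → Vec na → Vec nfd
  Aa : Mat na na
  Ga : Mat na nfa
  fa : Vec nd → Vec na → Vec nfa

namespace NDAE

variable {nd na nu nfd nfa : ℕ}

/-- `f_d` and `f_a` are smooth and vanish at the origin. -/
structure SmoothVanishing (S : NDAE nd na nu nfd nfa) : Prop where
  smooth_fd : ContDiff ℝ ∞ (fun p : Vec nd × Vec na => S.fd p.1 p.2)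
  smooth_fa : ContDiff ℝ ∞ (fun p : Vec nd × Vec na => S.fa p.1 p.2)
  fd_zero : S.fd 0 0 = 0
  fa_zero : S.fa 0 0 = 0

/-- `f_d` and `f_a` are quadratically bounded on `Xd × Xa`, with the four bounding matrices
`Hdd = H_d^d`, `Had = H_a^d`, `Hda = H_d^a`, `Haa = H_a^a` (lower index: the state that is
multiplied; upper index: the nonlinearity that is bounded). -/
def QuadBounded (S : NDAE nd na nu nfd nfa) (Xd : Set (Vec nd)) (Xa : Set (Vec na))
    {m₁ m₂ m₃ m₄ : ℕ} (Hdd : Mat m₁ nd) (Had : Mat m₂ na) (Hda : Mat m₃ nd) (Haa : Mat m₄ na) :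
    Prop :=
  ∀ xd ∈ Xd, ∀ xa ∈ Xa,
    ‖S.fd xd xa‖ ^ 2 ≤ ‖Hdd.app xd‖ ^ 2 + ‖Had.app xa‖ ^ 2 ∧
    ‖S.fa xd xa‖ ^ 2 ≤ ‖Hda.app xd‖ ^ 2 + ‖Haa.app xa‖ ^ 2

/-- The partial Jacobian matrix `∂f_a / ∂x_a` at `(xd, xa)`. -/
noncomputable def jacobianFa (S : NDAE nd na nu nfd nfa) (xd : Vec nd) (xa : Vec na) :
    Mat nfa na :=
  Matrix.of fun i j => (fderiv ℝ (S.fa xd) xa (EuclideanSpace.single j 1)).ofLp i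

/-- The rank (index-one) condition on `Xd × Xa`: the Jacobian of the algebraic equation with
respect to the algebraic state has full rank. -/
def IndexOne (S : NDAE nd na nu nfd nfa) (Xd : Set (Vec nd)) (Xa : Set (Vec na)) : Prop :=
  ∀ xd ∈ Xd, ∀ xa ∈ Xa, (S.Aa + S.Ga * S.jacobianFa xd xa).rank = na

/-- `(xd, xa)` is a solution on `[t₀, ∞)`, with values in `Xd × Xa`, of the closed loop with
the state feedback `u = K x_d`. The derivative at `t₀` is one-sided, and `xa` may be any
function that solves the algebraic equation. -/
structure IsClosedLoopSolution (S : NDAE nd na nu nfd nfa) (K : Mat nu nd)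
    (Xd : Set (Vec nd)) (Xa : Set (Vec na)) (t₀ : ℝ) (xd : ℝ → Vec nd) (xa : ℝ → Vec na) :
    Prop where
  mem_Xd : ∀ t ≥ t₀, xd t ∈ Xd
  mem_Xa : ∀ t ≥ t₀, xa t ∈ Xa
  differential : ∀ t ≥ t₀, ∃ v : Vec nd, HasDerivWithinAt xd v (Set.Ici t₀) t ∧
    S.Ed.app v = Mat.app (S.Ad + S.Bd * K) (xd t) + S.Gd.app (S.fd (xd t) (xa t))
  algebraic : ∀ t ≥ t₀, 0 = S.Aa.app (xa t) + S.Ga.app (S.fa (xd t) (xa t))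

/-- The closed loop is asymptotically stable around the origin in the operating region
`Xd × Xa`: the origin is (uniformly) Lyapunov stable, and both components of every solution in
the operating region tend to `0`. -/
def AsymptoticallyStable (S : NDAE nd na nu nfd nfa) (K : Mat nu nd)
    (Xd : Set (Vec nd)) (Xa : Set (Vec na)) : Prop :=
  (∀ ε > 0, ∃ δ > 0, ∀ t₀ xd xa, S.IsClosedLoopSolution K Xd Xa t₀ xd xa →
    ‖xd t₀‖ < δ → ‖xa t₀‖ < δ → ∀ t ≥ t₀, ‖xd t‖ < ε ∧ ‖xa t‖ < ε) ∧
  (∀ t₀ xd xa, S.IsClosedLoopSolution K Xd Xa t₀ xd xa →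
    Tendsto (fun t => ‖xd t‖) atTop (𝓝 0) ∧ Tendsto (fun t => ‖xa t‖) atTop (𝓝 0))

/-- The symmetric block matrix of the LMI, as a function of the bounding matrices and of the
variables `X₁, X₂, R, Y, W, ε`. The index set is `(nd + na) + (nd + na)`; `CFC.sqrt` is the
positive semidefinite square root, taken of `H̄_d = H_d^dᵀ H_d^d + H_d^aᵀ H_d^a` and of
`H̄_a = H_a^dᵀ H_a^d + H_a^aᵀ H_a^a`. -/
noncomputable def lmiMatrix (S : NDAE nd na nu nfd nfa)
    {m₁ m₂ m₃ m₄ : ℕ} (Hdd : Mat m₁ nd) (Had : Mat m₂ na) (Hda : Mat m₃ nd) (Haa : Mat m₄ na)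
    (X₁ : Mat nd nd) (X₂ : Mat na nd) (R : Mat na na) (Y : Mat na nd) (W : Mat nu nd) (ε : ℝ) :
    Matrix ((Fin nd ⊕ Fin na) ⊕ (Fin nd ⊕ Fin na)) ((Fin nd ⊕ Fin na) ⊕ (Fin nd ⊕ Fin na)) ℝ :=
  let sqrtHd : Mat nd nd := CFC.sqrt (Hddᵀ * Hdd + Hdaᵀ * Hda)
  let sqrtHa : Mat na na := CFC.sqrt (Hadᵀ * Had + Haaᵀ * Haa)
  let Ψ : Mat nd nd := S.Ed * X₁ * S.Adᵀ + S.Ad * X₁ * S.Edᵀ + S.Ed * Wᵀ * S.Bdᵀ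
    + S.Bd * W * S.Edᵀ + ε • (S.Gd * S.Gdᵀ)
  let Θ : Mat na na := Rᵀ * S.Aaᵀ + S.Aa * R + ε • (S.Ga * S.Gaᵀ)
  let L₂₁ : Mat na nd := S.Aa * X₂ * S.Edᵀ + S.Aa * Y
  let N := Matrix.fromBlocks
    (sqrtHd * X₁ * S.Edᵀ) (0 : Mat nd na)
    (sqrtHa * X₂ * S.Edᵀ + sqrtHa * Y) (sqrtHa * R)
  Matrix.fromBlocks
    (Matrix.fromBlocks Ψ L₂₁ᵀ L₂₁ Θ) Nᵀ
    N (Matrix.fromBlocks (-(ε • (1 : Mat nd nd))) 0 0 (-(ε • (1 : Mat na na))))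

/-- `(X₁, X₂, R, Y, W, ε)` is feasible: `X₁` is symmetric positive definite, `ε > 0`, and the
matrix of the LMI is (symmetric) negative definite. -/
def LMIFeasible (S : NDAE nd na nu nfd nfa)
    {m₁ m₂ m₃ m₄ : ℕ} (Hdd : Mat m₁ nd) (Had : Mat m₂ na) (Hda : Mat m₃ nd) (Haa : Mat m₄ na)
    (X₁ : Mat nd nd) (X₂ : Mat na nd) (R : Mat na na) (Y : Mat na nd) (W : Mat nu nd) (ε : ℝ) :
    Prop :=
  X₁.PosDef ∧ 0 < ε ∧ (-(S.lmiMatrix Hdd Had Hda Haa X₁ X₂ R Y W ε)).PosDef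

end NDAE

/-! The Lyapunov function is `V = xdᵀ X₁⁻¹ xd`. Feasibility makes `Edᵀ` and `R` invertible, so every
state can be written as `xd = X₁ Edᵀ a`, `xa = X₂ Edᵀ a + Y a + R b`. Then `V' = 2 a·(Ed xd')`, and
`2 b·(Aa xa + Ga fa) = 0` may be added for free: `b` is a multiplier for the algebraic equation.
Young's inequality with weight `ε` and the quadratic bounds remove `fd` and `fa`. What remains is
the LMI form with its last two blocks maximised out (a Schur complement), hence `V' ≤ -c(‖xd‖² +
‖xa‖²)` (`exists_dissipation`).

This one estimate is used twice. Dropping `xa`, it gives exponential decay of `xd`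
(`Mat.exists_exp_decay`). Keeping `xa`, and bounding `|V'|` by a multiple of `‖xd‖ (‖xd‖ + ‖xa‖)`,
it gives `‖xa‖ ≤ C ‖xd‖` (`exists_norm_algebraic_le`), so `xa` decays too. -/

/-! ### Quadratic forms and matrix-vector estimates -/

open Matrix in
theorem Matrix.dotProduct_transpose_mulVec_comm {m n : Type*} [Fintype m] [Fintype n]
    (M : Matrix m n ℝ) (v : n → ℝ) (w : m → ℝ) :
    v ⬝ᵥ (Mᵀ *ᵥ w) = w ⬝ᵥ (M *ᵥ v) := by
  rw [dotProduct_mulVec, vecMul_transpose, dotProduct_comm]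

open Matrix in
theorem Matrix.dotProduct_mulVec_self_eq {m n : Type*} [Fintype m] [Fintype n]
    (M : Matrix m n ℝ) (v : n → ℝ) :
    v ⬝ᵥ ((Mᵀ * M) *ᵥ v) = (M *ᵥ v) ⬝ᵥ (M *ᵥ v) := by
  rw [← mulVec_mulVec, dotProduct_transpose_mulVec_comm]

/-- The quadratic form of a positive definite matrix dominates a multiple of the squared norm. -/
theorem Matrix.PosDef.exists_pos_le_dotProduct_mulVec {ι : Type*} [Fintype ι]
    {M : Matrix ι ι ℝ} (hM : M.PosDef) :
    ∃ c > 0, ∀ v : ι → ℝ, c * (v ⬝ᵥ v) ≤ v ⬝ᵥ (M *ᵥ v) := by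
  have hcont : Continuous fun v : EuclideanSpace ℝ ι => v.ofLp ⬝ᵥ (M *ᵥ v.ofLp) := by
    have : Continuous fun v : EuclideanSpace ℝ ι => v.ofLp := PiLp.continuous_ofLp 2 _
    exact this.dotProduct (continuous_const.matrix_mulVec this)
  have hnorm (v : EuclideanSpace ℝ ι) : ‖v‖ ^ 2 = v.ofLp ⬝ᵥ v.ofLp := by
    rw [EuclideanSpace.real_norm_sq_eq]
    simp [dotProduct, sq]
  have hpos (v : EuclideanSpace ℝ ι) (hv : v ∈ Metric.sphere (0 : EuclideanSpace ℝ ι) 1) :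
      0 < v.ofLp ⬝ᵥ (M *ᵥ v.ofLp) := by
    have hv0 : v.ofLp ≠ 0 := by
      intro h
      have : v = 0 := by ext i; simp [h]
      simp [this] at hv
    simpa using hM.dotProduct_mulVec_pos hv0
  obtain ⟨c, hc, hle⟩ : ∃ c > 0, ∀ v ∈ Metric.sphere (0 : EuclideanSpace ℝ ι) 1,
      c ≤ v.ofLp ⬝ᵥ (M *ᵥ v.ofLp) := by
    -- In dimension zero the sphere is empty and any constant serves.
    rcases (Metric.sphere (0 : EuclideanSpace ℝ ι) 1).eq_empty_or_nonempty with h | h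
    · exact ⟨1, one_pos, by simp [h]⟩
    · obtain ⟨w, hw, hmin⟩ := (isCompact_sphere _ _).exists_isMinOn h hcont.continuousOn
      exact ⟨_, hpos w hw, fun v hv => hmin hv⟩
  refine ⟨c, hc, fun v => ?_⟩
  by_cases hv : v = 0
  · simp [hv]
  set w : EuclideanSpace ℝ ι := WithLp.toLp 2 v with hw
  have hw0 : ‖w‖ ≠ 0 := by simpa [hw] using hv
  have h := hle (‖w‖⁻¹ • w) (by simp [norm_smul, hw0])
  have hvv : v ⬝ᵥ v = ‖w‖ ^ 2 := (hnorm w).symm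
  simp only [WithLp.ofLp_smul, mulVec_smul, dotProduct_smul, smul_dotProduct, smul_eq_mul,
    hw] at h
  rw [hvv]
  calc c * ‖w‖ ^ 2 ≤ (‖w‖⁻¹ * (‖w‖⁻¹ * (v ⬝ᵥ (M *ᵥ v)))) * ‖w‖ ^ 2 := by gcongr
    _ = v ⬝ᵥ (M *ᵥ v) := by field_simp

namespace Mat

variable {l m n : ℕ}

theorem norm_sq_eq_dotProduct (x : Vec n) : ‖x‖ ^ 2 = x.ofLp ⬝ᵥ x.ofLp := by
  rw [EuclideanSpace.real_norm_sq_eq]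
  simp [dotProduct, sq]

theorem inner_eq_dotProduct (x y : Vec n) : inner ℝ x y = x.ofLp ⬝ᵥ y.ofLp := by
  simp [PiLp.inner_apply, dotProduct, mul_comm]

theorem exists_pos_norm_app_le (M : Mat m n) : ∃ C > 0, ∀ x, ‖M.app x‖ ≤ C * ‖x‖ := by
  let L : Vec n →L[ℝ] Vec m := LinearMap.toContinuousLinearMap (Matrix.toEuclideanLin M)
  obtain ⟨C, hC, h⟩ := L.bound
  exact ⟨C, hC, fun x => h x⟩

theorem hasDerivWithinAt_app (M : Mat m n) {x : ℝ → Vec n} {v : Vec n} {s : Set ℝ} {t : ℝ}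
    (hx : HasDerivWithinAt x v s t) : HasDerivWithinAt (fun t => M.app (x t)) (M.app v) s t := by
  let L : Vec n →L[ℝ] Vec m := LinearMap.toContinuousLinearMap (Matrix.toEuclideanLin M)
  exact L.hasFDerivAt.comp_hasDerivWithinAt t hx

end Mat

namespace Matrix

variable {m n : Type*} [Fintype m] [Fintype n] [DecidableEq n]

theorem sqrt_transpose (M : Matrix n n ℝ) : (CFC.sqrt M)ᵀ = CFC.sqrt M := by
  have h := (nonneg_iff_posSemidef.1 (CFC.sqrt_nonneg M)).1
  simpa [IsHermitian, conjTranspose_eq_transpose_of_trivial] using h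

theorem dotProduct_sqrt_mulVec_self {M : Matrix n n ℝ} (hM : M.PosSemidef) (v : n → ℝ) :
    (CFC.sqrt M *ᵥ v) ⬝ᵥ (CFC.sqrt M *ᵥ v) = v ⬝ᵥ (M *ᵥ v) := by
  rw [← dotProduct_mulVec_self_eq, sqrt_transpose, CFC.sqrt_mul_sqrt_self M hM.nonneg]

theorem dotProduct_fromBlocks_mulVec {m n : Type*} [Fintype m] [Fintype n] [DecidableEq m]
    [DecidableEq n] (P : Matrix m m ℝ) (L : Matrix n m ℝ) (T : Matrix n n ℝ)
    (N₁ : Matrix m m ℝ) (N₂ : Matrix n m ℝ) (N₃ : Matrix n n ℝ) (ε : ℝ)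
    (a p : m → ℝ) (b q : n → ℝ) :
    Sum.elim (Sum.elim a b) (Sum.elim p q) ⬝ᵥ
      (fromBlocks (fromBlocks P Lᵀ L T) (fromBlocks N₁ 0 N₂ N₃)ᵀ (fromBlocks N₁ 0 N₂ N₃)
        (fromBlocks (-(ε • 1)) 0 0 (-(ε • 1))) *ᵥ Sum.elim (Sum.elim a b) (Sum.elim p q)) =
      a ⬝ᵥ (P *ᵥ a) + 2 * (b ⬝ᵥ (L *ᵥ a)) + b ⬝ᵥ (T *ᵥ b) + 2 * (p ⬝ᵥ (N₁ *ᵥ a)) +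
        2 * (q ⬝ᵥ (N₂ *ᵥ a + N₃ *ᵥ b)) - ε * (p ⬝ᵥ p) - ε * (q ⬝ᵥ q) := by
  simp only [fromBlocks_transpose, fromBlocks_mulVec, Sum.elim_comp_inl, Sum.elim_comp_inr,
    sumElim_dotProduct_sumElim, dotProduct_add, dotProduct_transpose_mulVec_comm, neg_mulVec,
    smul_mulVec, one_mulVec, dotProduct_neg, dotProduct_smul, smul_eq_mul, transpose_zero,
    zero_mulVec, dotProduct_zero, Sum.elim_add_add]
  ring

end Matrix

/-! ### The LMI: convexity, its quadratic form, invertibility -/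

namespace NDAE

open Matrix

variable {nd na nu nfd nfa m₁ m₂ m₃ m₄ : ℕ}

/-- Every block is homogeneous of degree one in the variables: the `Gd Gdᵀ`, `Ga Gaᵀ` and identity
terms all carry the factor `ε`. Convexity then reduces to that of the positive definite cone. -/
theorem lmiMatrix_smul_add_smul (S : NDAE nd na nu nfd nfa)
    (Hdd : Mat m₁ nd) (Had : Mat m₂ na) (Hda : Mat m₃ nd) (Haa : Mat m₄ na)
    (X₁ X₁' : Mat nd nd) (X₂ X₂' : Mat na nd) (R R' : Mat na na) (Y Y' : Mat na nd)
    (W W' : Mat nu nd) (ε ε' r s : ℝ) :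
    S.lmiMatrix Hdd Had Hda Haa (r • X₁ + s • X₁') (r • X₂ + s • X₂') (r • R + s • R')
      (r • Y + s • Y') (r • W + s • W') (r * ε + s * ε') =
    r • S.lmiMatrix Hdd Had Hda Haa X₁ X₂ R Y W ε +
      s • S.lmiMatrix Hdd Had Hda Haa X₁' X₂' R' Y' W' ε' := by
  simp only [lmiMatrix, fromBlocks_smul, fromBlocks_add, fromBlocks_transpose, transpose_add,
    transpose_smul, Matrix.mul_add, Matrix.add_mul, Matrix.mul_smul, Matrix.smul_mul,
    smul_zero, add_zero, transpose_zero]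
  congr 1 <;> congr 1 <;> module

theorem convex_setOf_LMIFeasible (S : NDAE nd na nu nfd nfa)
    (Hdd : Mat m₁ nd) (Had : Mat m₂ na) (Hda : Mat m₃ nd) (Haa : Mat m₄ na) :
    Convex ℝ {z : Mat nd nd × Mat na nd × Mat na na × Mat na nd × Mat nu nd × ℝ |
      S.LMIFeasible Hdd Had Hda Haa z.1 z.2.1 z.2.2.1 z.2.2.2.1 z.2.2.2.2.1 z.2.2.2.2.2} := by
  rw [convex_iff_forall_pos]
  rintro ⟨X₁, X₂, R, Y, W, ε⟩ ⟨h1, h2, h3⟩ ⟨X₁', X₂', R', Y', W', ε'⟩ ⟨h1', h2', h3'⟩ r s hr hs -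
  refine ⟨(h1.smul hr).add (h1'.smul hs), ?_, ?_⟩
  · exact add_pos (mul_pos hr h2) (mul_pos hs h2')
  · have := (h3.smul hr).add (h3'.smul hs)
    simp only [Prod.fst_add, Prod.snd_add, Prod.smul_fst, Prod.smul_snd, smul_eq_mul,
      lmiMatrix_smul_add_smul]
    rwa [neg_add, ← smul_neg, ← smul_neg]

/-- The quadratic form of the LMI matrix, at the last two block components that maximise it. -/
theorem dotProduct_lmiMatrix_mulVec (S : NDAE nd na nu nfd nfa)
    (Hdd : Mat m₁ nd) (Had : Mat m₂ na) (Hda : Mat m₃ nd) (Haa : Mat m₄ na)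
    {X₁ : Mat nd nd} (X₂ : Mat na nd) (R : Mat na na) (Y : Mat na nd) (W : Mat nu nd) {ε : ℝ}
    (hX : X₁ᵀ = X₁) (hε : ε ≠ 0) (a : Fin nd → ℝ) (b : Fin na → ℝ)
    {x : Fin nd → ℝ} {z : Fin na → ℝ} (hx : x = X₁ *ᵥ (S.Edᵀ *ᵥ a))
    (hz : z = X₂ *ᵥ (S.Edᵀ *ᵥ a) + Y *ᵥ a + R *ᵥ b) :
    ∃ u : (Fin nd ⊕ Fin na) ⊕ (Fin nd ⊕ Fin na) → ℝ, a ⬝ᵥ a + b ⬝ᵥ b ≤ u ⬝ᵥ u ∧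
      u ⬝ᵥ (S.lmiMatrix Hdd Had Hda Haa X₁ X₂ R Y W ε *ᵥ u) =
        2 * (a ⬝ᵥ (S.Ad *ᵥ x)) + 2 * (a ⬝ᵥ (S.Bd *ᵥ (W *ᵥ (S.Edᵀ *ᵥ a)))) +
        2 * (b ⬝ᵥ (S.Aa *ᵥ z)) +
        ε * ((S.Gdᵀ *ᵥ a) ⬝ᵥ (S.Gdᵀ *ᵥ a) + (S.Gaᵀ *ᵥ b) ⬝ᵥ (S.Gaᵀ *ᵥ b)) +
        ε⁻¹ * ((Hdd *ᵥ x) ⬝ᵥ (Hdd *ᵥ x) + (Hda *ᵥ x) ⬝ᵥ (Hda *ᵥ x) +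
          ((Had *ᵥ z) ⬝ᵥ (Had *ᵥ z) + (Haa *ᵥ z) ⬝ᵥ (Haa *ᵥ z))) := by
  have hsq {k l k' : ℕ} (H : Mat k l) (H' : Mat k' l) (v : Fin l → ℝ) :
      (CFC.sqrt (Hᵀ * H + H'ᵀ * H') *ᵥ v) ⬝ᵥ (CFC.sqrt (Hᵀ * H + H'ᵀ * H') *ᵥ v) =
        (H *ᵥ v) ⬝ᵥ (H *ᵥ v) + (H' *ᵥ v) ⬝ᵥ (H' *ᵥ v) := by
    have h1 : (Hᵀ * H).PosSemidef := by
      simpa [conjTranspose_eq_transpose_of_trivial] using posSemidef_conjTranspose_mul_self H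
    have h2 : (H'ᵀ * H').PosSemidef := by
      simpa [conjTranspose_eq_transpose_of_trivial] using posSemidef_conjTranspose_mul_self H'
    rw [dotProduct_sqrt_mulVec_self (h1.add h2), add_mulVec, dotProduct_add,
      dotProduct_mulVec_self_eq, dotProduct_mulVec_self_eq]
  rw [← hsq Hdd Hda x, ← hsq Had Haa z]
  unfold lmiMatrix
  set sd : Mat nd nd := CFC.sqrt (Hddᵀ * Hdd + Hdaᵀ * Hda)
  set sa : Mat na na := CFC.sqrt (Hadᵀ * Had + Haaᵀ * Haa)
  -- For `ε > 0`, `2 p·(sd x) - ε p·p` is largest at `p = ε⁻¹ sd x`, with value `ε⁻¹ ‖sd x‖²`;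
  -- likewise for `q` and `sa z`.
  refine ⟨Sum.elim (Sum.elim a b) (Sum.elim (ε⁻¹ • sd *ᵥ x) (ε⁻¹ • sa *ᵥ z)), ?_, ?_⟩
  · simp only [sumElim_dotProduct_sumElim]
    have h1 (k : ℕ) (v : Fin k → ℝ) : 0 ≤ v ⬝ᵥ v :=
      Finset.sum_nonneg fun i _ => mul_self_nonneg (v i)
    linarith [h1 _ (ε⁻¹ • sd *ᵥ x), h1 _ (ε⁻¹ • sa *ᵥ z)]
  have hsymm {k : ℕ} (M : Mat k k) (v : Fin k → ℝ) : v ⬝ᵥ (Mᵀ *ᵥ v) = v ⬝ᵥ (M *ᵥ v) :=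
    dotProduct_transpose_mulVec_comm M v v
  have hA := hsymm (S.Ad * X₁ * S.Edᵀ) a
  have hW := hsymm (S.Bd * W * S.Edᵀ) a
  have hG := dotProduct_mulVec_self_eq S.Gdᵀ a
  have hR := hsymm (S.Aa * R) b
  have hGa := dotProduct_mulVec_self_eq S.Gaᵀ b
  simp only [transpose_mul, transpose_transpose, hX, ← Matrix.mul_assoc] at hA hW hG hR hGa
  have hx' : (sd * X₁ * S.Edᵀ) *ᵥ a = sd *ᵥ x := by
    simp only [hx, mulVec_mulVec, Matrix.mul_assoc]
  have hz' : (sa * X₂ * S.Edᵀ + sa * Y) *ᵥ a + (sa * R) *ᵥ b = sa *ᵥ z := by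
    simp only [hz, mulVec_mulVec, Matrix.mul_assoc, add_mulVec, mulVec_add]
  have hAa : b ⬝ᵥ ((S.Aa * X₂ * S.Edᵀ + S.Aa * Y) *ᵥ a) + b ⬝ᵥ ((S.Aa * R) *ᵥ b) =
      b ⬝ᵥ (S.Aa *ᵥ z) := by
    simp only [hz, mulVec_mulVec, Matrix.mul_assoc, add_mulVec, mulVec_add, dotProduct_add]
  have hAd : a ⬝ᵥ ((S.Ad * X₁ * S.Edᵀ) *ᵥ a) = a ⬝ᵥ (S.Ad *ᵥ x) := by
    simp only [hx, mulVec_mulVec, Matrix.mul_assoc]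
  have hBd : a ⬝ᵥ ((S.Bd * W * S.Edᵀ) *ᵥ a) = a ⬝ᵥ (S.Bd *ᵥ (W *ᵥ (S.Edᵀ *ᵥ a))) := by
    simp only [mulVec_mulVec, Matrix.mul_assoc]
  rw [dotProduct_fromBlocks_mulVec, hx', hz', ← hAa, ← hAd, ← hBd]
  simp only [add_mulVec, dotProduct_add, smul_mulVec, dotProduct_smul, smul_dotProduct,
    smul_eq_mul, hA, hW, hG, hR, hGa]
  field_simp
  ring

/-- The diagonal blocks `Ψ` and `Θ` must be negative definite. On a kernel vector of `Edᵀ` (resp.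
`R`) every term vanishes except `ε ‖Gdᵀ a‖²` (resp. `ε ‖Gaᵀ b‖²`), which is nonnegative. -/
theorem LMIFeasible.isUnit {S : NDAE nd na nu nfd nfa}
    {Hdd : Mat m₁ nd} {Had : Mat m₂ na} {Hda : Mat m₃ nd} {Haa : Mat m₄ na}
    {X₁ : Mat nd nd} {X₂ : Mat na nd} {R : Mat na na} {Y : Mat na nd} {W : Mat nu nd} {ε : ℝ}
    (h : S.LMIFeasible Hdd Had Hda Haa X₁ X₂ R Y W ε) :
    IsUnit S.Edᵀ ∧ IsUnit R := by
  obtain ⟨-, hε, h⟩ := h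
  have hnn {k : ℕ} (v : Fin k → ℝ) : 0 ≤ v ⬝ᵥ v :=
    Finset.sum_nonneg fun i _ => mul_self_nonneg (v i)
  unfold lmiMatrix at h
  constructor
  · rw [← mulVec_injective_iff_isUnit]
    refine (injective_iff_map_eq_zero S.Edᵀ.mulVecLin).2 fun a ha => ?_
    rw [mulVecLin_apply] at ha
    by_contra ha0
    have hu : (Sum.elim (Sum.elim a (0 : Fin na → ℝ))
        (Sum.elim (0 : Fin nd → ℝ) (0 : Fin na → ℝ))) ≠ 0 := fun h =>
      ha0 (funext fun i => congrFun h (Sum.inl (Sum.inl i)))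
    have h1 := h.dotProduct_mulVec_pos hu
    rw [star_trivial, neg_mulVec, dotProduct_neg, dotProduct_fromBlocks_mulVec] at h1
    have hA := dotProduct_transpose_mulVec_comm (S.Ad * X₁ᵀ * S.Edᵀ) a a
    have hW := dotProduct_transpose_mulVec_comm (S.Bd * W * S.Edᵀ) a a
    have hG := dotProduct_mulVec_self_eq S.Gdᵀ a
    simp only [transpose_mul, transpose_transpose, ← Matrix.mul_assoc] at hA hW hG
    have hk {k : ℕ} (M : Mat k nd) : (M * S.Edᵀ) *ᵥ a = 0 := by
      rw [← mulVec_mulVec, ha, mulVec_zero]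
    simp [add_mulVec, hA, hW, hG, hk, smul_mulVec] at h1
    exact absurd (mul_nonneg hε.le (hnn (S.Gdᵀ *ᵥ a))) (not_le.2 h1)
  · rw [← mulVec_injective_iff_isUnit]
    refine (injective_iff_map_eq_zero R.mulVecLin).2 fun b hb => ?_
    rw [mulVecLin_apply] at hb
    by_contra hb0
    have hu : (Sum.elim (Sum.elim (0 : Fin nd → ℝ) b)
        (Sum.elim (0 : Fin nd → ℝ) (0 : Fin na → ℝ))) ≠ 0 := fun h =>
      hb0 (funext fun i => congrFun h (Sum.inl (Sum.inr i)))
    have h1 := h.dotProduct_mulVec_pos hu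
    rw [star_trivial, neg_mulVec, dotProduct_neg, dotProduct_fromBlocks_mulVec] at h1
    have hA := dotProduct_transpose_mulVec_comm (S.Aa * R) b b
    have hG := dotProduct_mulVec_self_eq S.Gaᵀ b
    simp only [transpose_mul, transpose_transpose] at hA hG
    have hk : (S.Aa * R) *ᵥ b = 0 := by
      rw [← mulVec_mulVec, hb, mulVec_zero]
    simp [add_mulVec, hA, hG, hk, smul_mulVec] at h1
    exact absurd (mul_nonneg hε.le (hnn (S.Gaᵀ *ᵥ b))) (not_le.2 h1)

end NDAE

/-! ### Pointwise estimates along the closed loop -/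

namespace NDAE

open Matrix

variable {nd na nu nfd nfa m₁ m₂ m₃ m₄ : ℕ}

/-- `xd, xa, v` satisfy the closed-loop equations at one instant, with `v` the derivative of the
dynamic state. -/
structure IsClosedLoopPoint (S : NDAE nd na nu nfd nfa) (K : Mat nu nd)
    (xd : Vec nd) (xa : Vec na) (v : Vec nd) : Prop where
  differential : S.Ed.app v = Mat.app (S.Ad + S.Bd * K) xd + S.Gd.app (S.fd xd xa)
  algebraic : 0 = S.Aa.app xa + S.Ga.app (S.fa xd xa)

theorem LMIFeasible.exists_dissipation {S : NDAE nd na nu nfd nfa}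
    {Xd : Set (Vec nd)} {Xa : Set (Vec na)}
    {Hdd : Mat m₁ nd} {Had : Mat m₂ na} {Hda : Mat m₃ nd} {Haa : Mat m₄ na}
    {X₁ : Mat nd nd} {X₂ : Mat na nd} {R : Mat na na} {Y : Mat na nd} {W : Mat nu nd} {ε : ℝ}
    (h : S.LMIFeasible Hdd Had Hda Haa X₁ X₂ R Y W ε)
    (hbound : S.QuadBounded Xd Xa Hdd Had Hda Haa) :
    ∃ c > 0, ∀ xd ∈ Xd, ∀ xa ∈ Xa, ∀ v, S.IsClosedLoopPoint (W * X₁⁻¹) xd xa v →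
      2 * inner ℝ (Mat.app X₁⁻¹ xd) v ≤ -c * (‖xd‖ ^ 2 + ‖xa‖ ^ 2) := by
  obtain ⟨hE, hR⟩ := h.isUnit
  obtain ⟨hX, hε, hM⟩ := h
  have hXt : X₁ᵀ = X₁ := by
    simpa [IsHermitian, conjTranspose_eq_transpose_of_trivial] using hX.1
  obtain ⟨c, hc, hle⟩ := hM.exists_pos_le_dotProduct_mulVec
  obtain ⟨C₁, hC₁, hb₁⟩ := Mat.exists_pos_norm_app_le (X₁ * S.Edᵀ)
  obtain ⟨C₂, hC₂, hb₂⟩ := Mat.exists_pos_norm_app_le (X₂ * S.Edᵀ + Y)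
  obtain ⟨C₃, hC₃, hb₃⟩ := Mat.exists_pos_norm_app_le R
  -- Chosen so that `‖xd‖² + ‖xa‖² ≤ D (‖a‖² + ‖b‖²)`, using `(s + t)² ≤ 2s² + 2t²` for `xa`.
  set D := C₁ ^ 2 + 2 * C₂ ^ 2 + 2 * C₃ ^ 2 with hD
  have hDpos : 0 < D := by positivity
  refine ⟨c / D, by positivity, fun xd hxd xa hxa v hv => ?_⟩
  set a : Fin nd → ℝ := (S.Edᵀ)⁻¹ *ᵥ (X₁⁻¹ *ᵥ xd.ofLp) with ha
  set b : Fin na → ℝ := R⁻¹ *ᵥ (xa.ofLp - X₂ *ᵥ (S.Edᵀ *ᵥ a) - Y *ᵥ a) with hb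
  have hEa : S.Edᵀ *ᵥ a = X₁⁻¹ *ᵥ xd.ofLp := by
    rw [ha, mulVec_mulVec, mul_nonsing_inv _ ((isUnit_iff_isUnit_det _).1 hE), one_mulVec]
  have hx : xd.ofLp = X₁ *ᵥ (S.Edᵀ *ᵥ a) := by
    rw [hEa, mulVec_mulVec, mul_nonsing_inv _ ((isUnit_iff_isUnit_det _).1 hX.isUnit), one_mulVec]
  have hz : xa.ofLp = X₂ *ᵥ (S.Edᵀ *ᵥ a) + Y *ᵥ a + R *ᵥ b := by
    rw [hb, mulVec_mulVec _ R, mul_nonsing_inv _ ((isUnit_iff_isUnit_det _).1 hR), one_mulVec]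
    abel
  obtain ⟨u, hu, hform⟩ := S.dotProduct_lmiMatrix_mulVec Hdd Had Hda Haa X₂ R Y W hXt hε.ne' a b
    hx hz
  have hlow := hle u
  rw [neg_mulVec, dotProduct_neg, hform] at hlow
  -- Young's inequality, from `ε⁻¹ ‖ε p - f‖² ≥ 0`.
  have hyoung {k : ℕ} (p f : Fin k → ℝ) :
      2 * (p ⬝ᵥ f) ≤ ε * (p ⬝ᵥ p) + ε⁻¹ * (f ⬝ᵥ f) := by
    have h0 : 0 ≤ (ε • p - f) ⬝ᵥ (ε • p - f) := Finset.sum_nonneg fun i _ => mul_self_nonneg _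
    simp only [sub_dotProduct, dotProduct_sub, smul_dotProduct, dotProduct_smul, smul_eq_mul,
      dotProduct_comm f p] at h0
    have h1 := mul_nonneg (inv_nonneg.2 hε.le) h0
    have h2 : ε⁻¹ * (ε * (ε * (p ⬝ᵥ p)) - ε * (p ⬝ᵥ f) - (ε * (p ⬝ᵥ f) - f ⬝ᵥ f)) =
      ε * (p ⬝ᵥ p) + ε⁻¹ * (f ⬝ᵥ f) - 2 * (p ⬝ᵥ f) := by
      field_simp
      ring
    linarith
  have hyd := hyoung (S.Gdᵀ *ᵥ a) (S.fd xd xa).ofLp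
  have hya := hyoung (S.Gaᵀ *ᵥ b) (S.fa xd xa).ofLp
  rw [dotProduct_comm, dotProduct_transpose_mulVec_comm S.Gd] at hyd
  rw [dotProduct_comm, dotProduct_transpose_mulVec_comm S.Ga] at hya
  obtain ⟨hfd, hfa⟩ := hbound xd hxd xa hxa
  simp only [Mat.norm_sq_eq_dotProduct, Mat.app] at hfd hfa
  have hf := mul_le_mul_of_nonneg_left (add_le_add hfd hfa) (inv_nonneg.2 hε.le)
  have hdiff := congrArg (fun w : Vec nd => a ⬝ᵥ w.ofLp) hv.differential
  have halg := congrArg (fun w : Vec na => b ⬝ᵥ w.ofLp) hv.algebraic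
  simp only [Mat.app, WithLp.ofLp_add, dotProduct_add, add_mulVec, ← mulVec_mulVec, ← hEa,
    WithLp.ofLp_zero, dotProduct_zero] at hdiff halg
  have hinner : inner ℝ (Mat.app X₁⁻¹ xd) v = a ⬝ᵥ (S.Ed *ᵥ v.ofLp) := by
    rw [Mat.inner_eq_dotProduct, Mat.app, ← hEa, dotProduct_comm,
      dotProduct_transpose_mulVec_comm]
  -- The `Ad`, `Bd` and `Aa` terms match the LMI form exactly, since `K xd = W Edᵀ a`; the `G` and
  -- `H` terms of the form absorb the nonlinearities.
  have hmain : 2 * inner ℝ (Mat.app X₁⁻¹ xd) v ≤ -c * (a ⬝ᵥ a + b ⬝ᵥ b) := by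
    rw [hinner, hdiff]
    have := mul_le_mul_of_nonneg_left hu hc.le
    linarith
  have hn₁ : ‖xd‖ ≤ C₁ * ‖(WithLp.toLp 2 a : Vec nd)‖ := by
    refine le_of_eq_of_le (congrArg _ ?_) (hb₁ (WithLp.toLp 2 a))
    rw [Mat.app, ← mulVec_mulVec, ← hx]
  have hn₂ : ‖xa‖ ≤ C₂ * ‖(WithLp.toLp 2 a : Vec nd)‖ + C₃ * ‖(WithLp.toLp 2 b : Vec na)‖ := by
    refine le_trans ?_ (add_le_add (hb₂ (WithLp.toLp 2 a)) (hb₃ (WithLp.toLp 2 b)))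
    refine le_of_eq_of_le (congrArg _ ?_) (norm_add_le _ _)
    rw [Mat.app, Mat.app, ← WithLp.toLp_add, add_mulVec, ← mulVec_mulVec, ← hz]
  have haa := Mat.norm_sq_eq_dotProduct (WithLp.toLp 2 a : Vec nd)
  have hbb := Mat.norm_sq_eq_dotProduct (WithLp.toLp 2 b : Vec na)
  simp only at haa hbb
  rw [← haa, ← hbb] at hmain
  set α := ‖(WithLp.toLp 2 a : Vec nd)‖
  set β := ‖(WithLp.toLp 2 b : Vec na)‖
  have hsq : ‖xd‖ ^ 2 + ‖xa‖ ^ 2 ≤ D * (α ^ 2 + β ^ 2) := by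
    have h1 : ‖xd‖ ^ 2 ≤ (C₁ * α) ^ 2 := by gcongr
    have h2 : ‖xa‖ ^ 2 ≤ (C₂ * α + C₃ * β) ^ 2 := by gcongr
    have h3 := sq_nonneg (C₂ * α - C₃ * β)
    have h4 : 0 ≤ (C₁ * β) ^ 2 + 2 * (C₂ * β) ^ 2 + 2 * (C₃ * α) ^ 2 := by positivity
    rw [hD]
    linarith
  have := mul_le_mul_of_nonneg_left hsq (by positivity : 0 ≤ c / D)
  rw [← mul_assoc, div_mul_cancel₀ _ hDpos.ne'] at this
  linarith

/-- Dissipation gives `c ‖xa‖² ≤ -V'`, while `-V'` is at most a multiple of `‖xd‖ ‖v‖`. Since `Ed`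
is invertible, `v` is linearly bounded by the state, so if `‖xd‖ ≤ ‖xa‖` one factor `‖xa‖` cancels.
-/
theorem LMIFeasible.exists_norm_algebraic_le {S : NDAE nd na nu nfd nfa}
    {Xd : Set (Vec nd)} {Xa : Set (Vec na)}
    {Hdd : Mat m₁ nd} {Had : Mat m₂ na} {Hda : Mat m₃ nd} {Haa : Mat m₄ na}
    {X₁ : Mat nd nd} {X₂ : Mat na nd} {R : Mat na na} {Y : Mat na nd} {W : Mat nu nd} {ε : ℝ}
    (h : S.LMIFeasible Hdd Had Hda Haa X₁ X₂ R Y W ε)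
    (hbound : S.QuadBounded Xd Xa Hdd Had Hda Haa) :
    ∃ C > 0, ∀ xd ∈ Xd, ∀ xa ∈ Xa, ∀ v, S.IsClosedLoopPoint (W * X₁⁻¹) xd xa v →
      ‖xa‖ ≤ C * ‖xd‖ := by
  obtain ⟨c, hc, hdiss⟩ := h.exists_dissipation hbound
  have hE : IsUnit S.Ed := by simpa using h.isUnit.1
  obtain ⟨C₁, hC₁, hb₁⟩ := Mat.exists_pos_norm_app_le X₁⁻¹
  obtain ⟨C₂, hC₂, hb₂⟩ := Mat.exists_pos_norm_app_le S.Ed⁻¹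
  obtain ⟨C₃, hC₃, hb₃⟩ := Mat.exists_pos_norm_app_le (S.Ad + S.Bd * (W * X₁⁻¹))
  obtain ⟨C₄, hC₄, hb₄⟩ := Mat.exists_pos_norm_app_le S.Gd
  obtain ⟨C₅, hC₅, hb₅⟩ := Mat.exists_pos_norm_app_le Hdd
  obtain ⟨C₆, hC₆, hb₆⟩ := Mat.exists_pos_norm_app_le Had
  set D := 2 * C₁ * (C₂ * (C₃ + C₄ * (C₅ + C₆))) with hD
  have hDpos : 0 < D := by positivity
  refine ⟨1 + D / c, by positivity, fun xd hxd xa hxa v hv => ?_⟩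
  rcases le_total ‖xa‖ ‖xd‖ with hle | hle
  · have : 0 ≤ D / c * ‖xd‖ := by positivity
    linarith
  have hf : ‖S.fd xd xa‖ ≤ (C₅ + C₆) * ‖xa‖ := by
    have h1 : ‖S.fd xd xa‖ ^ 2 ≤ (C₅ * ‖xd‖) ^ 2 + (C₆ * ‖xa‖) ^ 2 :=
      (hbound xd hxd xa hxa).1.trans (by gcongr; exacts [hb₅ xd, hb₆ xa])
    have h2 : ‖S.fd xd xa‖ ≤ C₅ * ‖xd‖ + C₆ * ‖xa‖ := by
      refine abs_le_of_sq_le_sq' ?_ (by positivity) |>.2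
      have : 0 ≤ 2 * (C₅ * ‖xd‖) * (C₆ * ‖xa‖) := by positivity
      linarith
    calc _ ≤ C₅ * ‖xd‖ + C₆ * ‖xa‖ := h2
      _ ≤ C₅ * ‖xa‖ + C₆ * ‖xa‖ := by gcongr
      _ = _ := by ring
  have hvn : ‖v‖ ≤ C₂ * (C₃ + C₄ * (C₅ + C₆)) * ‖xa‖ := by
    have hEv : Mat.app S.Ed⁻¹ (S.Ed.app v) = v := by
      rw [Mat.app, Mat.app, mulVec_mulVec, nonsing_inv_mul _ ((isUnit_iff_isUnit_det _).1 hE),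
        one_mulVec]
    calc ‖v‖ ≤ C₂ * ‖S.Ed.app v‖ := by simpa only [hEv] using hb₂ (S.Ed.app v)
      _ ≤ C₂ * (C₃ * ‖xd‖ + C₄ * ‖S.fd xd xa‖) := by
        rw [hv.differential]
        gcongr
        exact (norm_add_le _ _).trans (add_le_add (hb₃ _) (hb₄ _))
      _ ≤ C₂ * (C₃ * ‖xa‖ + C₄ * ((C₅ + C₆) * ‖xa‖)) := by gcongr
      _ = _ := by ring
  have hin : -(2 * inner ℝ (Mat.app X₁⁻¹ xd) v) ≤ D * ‖xd‖ * ‖xa‖ := by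
    have h1 := neg_le_of_abs_le (abs_real_inner_le_norm (Mat.app X₁⁻¹ xd) v)
    have h2 : ‖Mat.app X₁⁻¹ xd‖ * ‖v‖ ≤
        C₁ * ‖xd‖ * (C₂ * (C₃ + C₄ * (C₅ + C₆)) * ‖xa‖) := by
      gcongr
      exact hb₁ xd
    calc _ ≤ 2 * (C₁ * ‖xd‖ * (C₂ * (C₃ + C₄ * (C₅ + C₆)) * ‖xa‖)) := by linarith
      _ = _ := by rw [hD]; ring
  have hz : c * ‖xa‖ * ‖xa‖ ≤ D * ‖xd‖ * ‖xa‖ := by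
    have h1 := hdiss xd hxd xa hxa v hv
    have h2 : 0 ≤ c * ‖xd‖ ^ 2 := by positivity
    linarith
  rcases (norm_nonneg xa).eq_or_lt with h0 | h0
  · rw [← h0]
    positivity
  · have h1 : ‖xa‖ ≤ D / c * ‖xd‖ := by
      rw [div_mul_eq_mul_div, le_div_iff₀ hc, mul_comm]
      exact le_of_mul_le_mul_right hz h0
    linarith [norm_nonneg xd]

end NDAE

/-! ### Lyapunov decay and asymptotic stability -/

open Matrix in
/-- Exponential decay from a quadratic Lyapunov function. -/
theorem Mat.exists_exp_decay {n : ℕ} {P : Mat n n} (hP : P.PosDef) {c : ℝ} (hc : 0 < c) :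
    ∃ M > 0, ∃ k > 0, ∀ (t₀ : ℝ) (x : ℝ → Vec n),
      (∀ t ≥ t₀, ∃ v, HasDerivWithinAt x v (Set.Ici t₀) t ∧
        2 * inner ℝ (P.app (x t)) v ≤ -c * ‖x t‖ ^ 2) →
      ∀ t ≥ t₀, ‖x t‖ ^ 2 ≤ M * ‖x t₀‖ ^ 2 * Real.exp (-(k * (t - t₀))) := by
  obtain ⟨m, hm, hlow⟩ := hP.exists_pos_le_dotProduct_mulVec
  obtain ⟨C, hC, hup⟩ := Mat.exists_pos_norm_app_le P
  have hsym (x y : Vec n) : inner ℝ (P.app x) y = inner ℝ (P.app y) x := by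
    have hPt : Pᵀ = P := by
      simpa [IsHermitian, conjTranspose_eq_transpose_of_trivial] using hP.1
    rw [inner_eq_dotProduct, inner_eq_dotProduct, Mat.app, Mat.app, dotProduct_comm,
      dotProduct_comm _ x.ofLp]
    nth_rw 1 [← hPt]
    rw [dotProduct_transpose_mulVec_comm]
  have hlow' (x : Vec n) : m * ‖x‖ ^ 2 ≤ inner ℝ (P.app x) x := by
    rw [norm_sq_eq_dotProduct, inner_eq_dotProduct, dotProduct_comm (P.app x).ofLp]
    exact hlow _
  have hup' (x : Vec n) : inner ℝ (P.app x) x ≤ C * ‖x‖ ^ 2 := by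
    calc _ ≤ ‖P.app x‖ * ‖x‖ := real_inner_le_norm _ _
      _ ≤ C * ‖x‖ * ‖x‖ := by gcongr; exact hup x
      _ = _ := by ring
  refine ⟨C / m, by positivity, c / C, by positivity, fun t₀ x hx t ht => ?_⟩
  set k := c / C with hk
  have hkpos : 0 < k := by positivity
  choose! v hv hdec using hx
  -- With the integrating factor, `F` is nonincreasing: `V ≤ C ‖x‖²` and `k = c / C` give `k V ≤ c
  -- ‖x‖² ≤ -V'`.
  let F : ℝ → ℝ := fun s => Real.exp (k * (s - t₀)) * inner ℝ (P.app (x s)) (x s)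
  have hF (s : ℝ) (hs : s ≥ t₀) : HasDerivWithinAt F
      (Real.exp (k * (s - t₀)) * (k * inner ℝ (P.app (x s)) (x s) +
        2 * inner ℝ (P.app (x s)) (v s))) (Set.Ici t₀) s := by
    have h1 : HasDerivWithinAt (fun s => Real.exp (k * (s - t₀)))
        (Real.exp (k * (s - t₀)) * (k * 1)) (Set.Ici t₀) s :=
      ((((hasDerivAt_id s).sub_const t₀).const_mul k).exp).hasDerivWithinAt
    have h2 := h1.mul ((hasDerivWithinAt_app P (hv s hs)).inner ℝ (hv s hs))
    refine h2.congr_deriv ?_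
    rw [hsym (v s)]
    ring
  have hanti : AntitoneOn F (Set.Ici t₀) := by
    have hint {s : ℝ} (hs : s ∈ interior (Set.Ici t₀)) :
        HasDerivAt F (Real.exp (k * (s - t₀)) * (k * inner ℝ (P.app (x s)) (x s) +
          2 * inner ℝ (P.app (x s)) (v s))) s :=
      (hF s (interior_subset hs)).hasDerivAt (mem_interior_iff_mem_nhds.1 hs)
    refine antitoneOn_of_deriv_nonpos (convex_Ici t₀)
      (fun s hs => (hF s hs).continuousWithinAt)
      (fun s hs => (hint hs).differentiableAt.differentiableWithinAt) fun s hs => ?_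
    rw [(hint hs).deriv]
    refine mul_nonpos_of_nonneg_of_nonpos (Real.exp_nonneg _) ?_
    have h1 := mul_le_mul_of_nonneg_left (hup' (x s)) hkpos.le
    rw [← mul_assoc, hk, div_mul_cancel₀ _ hC.ne', ← hk] at h1
    linarith [hdec s (interior_subset hs)]
  have h1 : F t ≤ F t₀ := hanti (Set.self_mem_Ici) ht ht
  have h2 : Real.exp (k * (t - t₀)) * (m * ‖x t‖ ^ 2) ≤ C * ‖x t₀‖ ^ 2 := by
    calc _ ≤ F t := mul_le_mul_of_nonneg_left (hlow' _) (Real.exp_nonneg _)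
      _ ≤ F t₀ := h1
      _ ≤ _ := by simpa [F] using hup' (x t₀)
  have h3 : ‖x t‖ ^ 2 * Real.exp (k * (t - t₀)) ≤ C / m * ‖x t₀‖ ^ 2 := by
    rw [div_mul_eq_mul_div C, le_div_iff₀ hm]
    linarith
  rw [Real.exp_neg, ← div_eq_mul_inv]
  exact (le_div_iff₀ (Real.exp_pos _)).2 h3

theorem NDAE.LMIFeasible.asymptoticallyStable {nd na nu nfd nfa m₁ m₂ m₃ m₄ : ℕ}
    {S : NDAE nd na nu nfd nfa} {Xd : Set (Vec nd)} {Xa : Set (Vec na)}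
    {Hdd : Mat m₁ nd} {Had : Mat m₂ na} {Hda : Mat m₃ nd} {Haa : Mat m₄ na}
    {X₁ : Mat nd nd} {X₂ : Mat na nd} {R : Mat na na} {Y : Mat na nd} {W : Mat nu nd} {ε : ℝ}
    (h : S.LMIFeasible Hdd Had Hda Haa X₁ X₂ R Y W ε)
    (hbound : S.QuadBounded Xd Xa Hdd Had Hda Haa) :
    S.AsymptoticallyStable (W * X₁⁻¹) Xd Xa := by
  obtain ⟨c, hc, hdiss⟩ := h.exists_dissipation hbound
  obtain ⟨C, hC, halg⟩ := h.exists_norm_algebraic_le hbound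
  obtain ⟨M, hM, k, hk, hdecay⟩ := Mat.exists_exp_decay h.1.inv hc
  have hxd {t₀ xd xa} (hs : S.IsClosedLoopSolution (W * X₁⁻¹) Xd Xa t₀ xd xa) (t : ℝ)
      (ht : t ≥ t₀) : ‖xd t‖ ^ 2 ≤ M * ‖xd t₀‖ ^ 2 * Real.exp (-(k * (t - t₀))) := by
    refine hdecay t₀ xd (fun s hst => ?_) t ht
    obtain ⟨v, hv, heq⟩ := hs.differential s hst
    refine ⟨v, hv, (hdiss _ (hs.mem_Xd s hst) _ (hs.mem_Xa s hst) v
      ⟨heq, hs.algebraic s hst⟩).trans ?_⟩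
    have : 0 ≤ c * ‖xa s‖ ^ 2 := by positivity
    linarith
  have hxa {t₀ xd xa} (hs : S.IsClosedLoopSolution (W * X₁⁻¹) Xd Xa t₀ xd xa) (t : ℝ)
      (ht : t ≥ t₀) : ‖xa t‖ ≤ C * ‖xd t‖ := by
    obtain ⟨v, -, heq⟩ := hs.differential t ht
    exact halg _ (hs.mem_Xd t ht) _ (hs.mem_Xa t ht) v ⟨heq, hs.algebraic t ht⟩
  refine ⟨fun ε hε => ?_, fun t₀ xd xa hs => ?_⟩
  · have hM' : 0 < Real.sqrt M := Real.sqrt_pos.2 hM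
    -- `√M` bounds the growth of `‖xd‖`, and `1 + C` dominates both `1` and `C`, so `(1 + C) ‖xd t‖
    -- < ε` controls both components.
    refine ⟨ε / ((1 + C) * Real.sqrt M), by positivity, fun t₀ xd xa hs hd _ t ht => ?_⟩
    have h1 : ‖xd t‖ ≤ Real.sqrt M * ‖xd t₀‖ := by
      refine (abs_le_of_sq_le_sq' ?_ (by positivity)).2
      rw [mul_pow, Real.sq_sqrt hM.le]
      refine (hxd hs t ht).trans (mul_le_of_le_one_right (by positivity) ?_)
      rw [Real.exp_le_one_iff, neg_nonpos]
      exact mul_nonneg hk.le (sub_nonneg.2 ht)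
    have h2 : (1 + C) * ‖xd t‖ < ε := by
      rw [lt_div_iff₀ (by positivity)] at hd
      calc _ ≤ (1 + C) * (Real.sqrt M * ‖xd t₀‖) := by gcongr
        _ = ‖xd t₀‖ * ((1 + C) * Real.sqrt M) := by ring
        _ < ε := hd
    have h3 := hxa hs t ht
    have h4 : 0 ≤ C * ‖xd t‖ := by positivity
    constructor <;> linarith [norm_nonneg (xd t)]
  · have hlim : Tendsto (fun t => M * ‖xd t₀‖ ^ 2 * Real.exp (-(k * (t - t₀)))) atTop (𝓝 0) := by
      have h1 : Tendsto (fun t => k * (t - t₀)) atTop atTop :=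
        (tendsto_atTop_add_const_right _ (-t₀) tendsto_id).const_mul_atTop hk
      simpa using (Real.tendsto_exp_neg_atTop_nhds_zero.comp h1).const_mul (M * ‖xd t₀‖ ^ 2)
    have hsq : Tendsto (fun t => ‖xd t‖ ^ 2) atTop (𝓝 0) :=
      tendsto_of_tendsto_of_tendsto_of_le_of_le' tendsto_const_nhds hlim
        (.of_forall fun t => by positivity)
        ((eventually_ge_atTop t₀).mono fun t ht => hxd hs t ht)
    have hd : Tendsto (fun t => ‖xd t‖) atTop (𝓝 0) := by
      simpa [Real.sqrt_sq] using hsq.sqrt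
    refine ⟨hd, tendsto_of_tendsto_of_tendsto_of_le_of_le' tendsto_const_nhds
      (by simpa using hd.const_mul C) (.of_forall fun t => norm_nonneg _)
      ((eventually_ge_atTop t₀).mono fun t ht => hxa hs t ht)⟩

theorem proposition1 {nd na nu nfd nfa m₁ m₂ m₃ m₄ : ℕ}
    (S : NDAE nd na nu nfd nfa) (Xd : Set (Vec nd)) (Xa : Set (Vec na))
    (Hdd : Mat m₁ nd) (Had : Mat m₂ na) (Hda : Mat m₃ nd) (Haa : Mat m₄ na)
    (hsmooth : S.SmoothVanishing)
    (hbound : S.QuadBounded Xd Xa Hdd Had Hda Haa)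
    (hindex : S.IndexOne Xd Xa) :
    Convex ℝ {z : Mat nd nd × Mat na nd × Mat na na × Mat na nd × Mat nu nd × ℝ |
      S.LMIFeasible Hdd Had Hda Haa z.1 z.2.1 z.2.2.1 z.2.2.2.1 z.2.2.2.2.1 z.2.2.2.2.2} ∧
    ∀ (X₁ : Mat nd nd) (X₂ : Mat na nd) (R : Mat na na) (Y : Mat na nd) (W : Mat nu nd) (ε : ℝ),
      S.LMIFeasible Hdd Had Hda Haa X₁ X₂ R Y W ε →
        S.AsymptoticallyStable (W * X₁⁻¹) Xd Xa := by
  exact ⟨S.convex_setOf_LMIFeasible Hdd Had Hda Haa,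
    fun X₁ X₂ R Y W ε h => h.asymptoticallyStable hbound⟩
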